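/- Let $\mathbb N$ be the set of positive integers, $\mathcal P_f(X)$ the set of nonempty finite subsets of $X$, and $\tau={}^{\mathbb N}\mathbb N$ the set of all functions $\mathbb N\to\mathbb N$. For $F,G\in\mathcal P_f(\mathbb N)$ write $F<G$ if $\max F<\min G$. Let $\beta\mathbb N$ be the set of ultrafilters on $\mathbb N$, with $A\in p+q$ iff $\{x:\{y:x+y\in A\}\in q\}\in p$, and, for $a\in\mathbb N$, $A\in ap$ iff $\{x:ax\in A\}\in p$. A set $A\subseteq\mathbb N$ is a $J$-set if for every $F\in\mathcal P_f(\tau)$ there are $b\in\mathbb N$ and $\beta\in\mathcal P_f(\mathbb N)$ such that $b+\sum_{t\in\beta}f(t)\in A$ for all $f\in F$; $\mathcal J$ is the set of those $p\in\beta\mathbb N$ all of whose members are $J$-sets. **Theorem.** Let $m\in\mathbb N$, $a_1,\dots,a_m\in\mathbb N$ and $A\subseteq\mathbb N$. (1) The following are equivalent: (i) There are functions $\alpha:\mathcal P_f(\tau)\to\mathbb N$ and $H:\mathcal P_f(\tau)\to\mathcal P_f(\mathbb N)$ such that $H(F)<H(G)$ whenever $F,G\in\mathcal P_f(\tau)$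 and $F\subsetneq G$, and such that for every sequence $G_1\subsetneq G_2\subsetneq\cdots$ in $\mathcal P_f(\tau)$, all $\beta_1<\dots<\beta_m$ in $\mathcal P_f(\mathbb N)$ and all $f_i\in G_i$ $(i\in\mathbb N)$, $$\sum_{j=1}^m a_j\Bigl(\sum_{i\in\beta_j}\alpha(G_i)+\sum_{i\in\beta_j}\sum_{t\in H(G_i)}f_i(t)\Bigr)\in A.$$ (ii) There is $p\in\mathcal J$ with $p+p=p$ and $A\in a_1p+a_2p+\dots+a_mp$. (2) The following are equivalent: (i) There are functions $\alpha_1,\dots,\alpha_m:\mathcal P_f(\tau)\to\mathbb N$ and $H_1,\dots,H_m:\mathcal P_f(\tau)\to\mathcal P_f(\mathbb N)$ such that $H_j(F)<H_j(G)$ for every $j$ whenever $F,G\in\mathcal P_f(\tau)$ and $F\subsetneq G$, and such that for every sequence $G_1\subsetneq G_2\subsetneq\cdots$ in $\mathcal P_f(\tau)$, all $\beta_1<\dots<\beta_m$ in $\mathcal P_f(\mathbb N)$ and all $f_i\in G_i$ $(i\in\mathbb N)$, $$\sum_{j=1}^m a_j\Bigl(\sum_{i\in\beta_j}\alpha_j(G_i)+\sum_{i\in\beta_j}\sum_{t\in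 H_j(G_i)}f_i(t)\Bigr)\in A.$$ (ii) There are $p_1,\dots,p_m\in\mathcal J$ with $p_j+p_j=p_j$ for every $j$ and $A\in a_1p_1+a_2p_2+\dots+a_mp_m$. (Each (i) is the case $T=\{\mathrm{id}\}$ of the condition in which, for a finite nonempty set $T$ of integer polynomials without constant term, the double sum in the $j$-th summand is replaced by $P_j$ of it and the membership is required for all $P_1,\dots,P_m\in T$.) -/

import Mathlib

/-! The positive integers are `ℕ+`, and `βℕ` is `Ultrafilter ℕ+`, with Mathlib's addition:
`A ∈ p + q ↔ {x | {y | x + y ∈ A} ∈ q} ∈ p`. -/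

attribute [local instance] Ultrafilter.add

/-- The nonempty finite subsets of `X`. -/
abbrev PosFin (X : Type) : Type := {F : Finset X // F.Nonempty}

/-- `max F < min G`, for nonempty finite sets of positive integers. -/
def Before (F G : PosFin ℕ+) : Prop := ∀ s ∈ F.1, ∀ t ∈ G.1, s < t

/-- The integer `z` is (a positive integer which is) an element of `A`. -/
def IntMem (z : ℤ) (A : Set ℕ+) : Prop := ∃ n ∈ A, (n : ℤ) = z

/-- `J`-sets. -/
def IsJSet (A : Set ℕ+) : Prop :=
  ∀ F : PosFin (ℕ+ → ℕ+), ∃ (b : ℕ+) (β : PosFin ℕ+), ∀ f ∈ F.1,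
    IntMem ((b : ℤ) + ∑ t ∈ β.1, (f t : ℤ)) A

/-- The ultrafilters all of whose members are `J`-sets. -/
def JUltrafilters : Set (Ultrafilter ℕ+) := {p | ∀ A ∈ p, IsJSet A}

/-- The ultrafilter `a p`: `A ∈ a p ↔ {x | a x ∈ A} ∈ p`. -/
def scaleUltrafilter (a : ℕ+) (p : Ultrafilter ℕ+) : Ultrafilter ℕ+ := p.map (fun x => a * x)

/-- The ultrafilter `a 0 p 0 + a 1 p 1 + ⋯ + a m p m`, in this order
(the addition of ultrafilters is associative but not commutative). -/
def linCombUltrafilter : (m : ℕ) → (Fin (m + 1) → ℕ+) → (Fin (m + 1) → Ultrafilter ℕ+) →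
    Ultrafilter ℕ+
  | 0, a, p => scaleUltrafilter (a 0) (p 0)
  | m + 1, a, p =>
      scaleUltrafilter (a 0) (p 0) +
        linCombUltrafilter m (fun i => a i.succ) (fun i => p i.succ)

/-- Polynomials with integer coefficients and no constant term. -/
abbrev PolyZero : Type := {P : Polynomial ℤ // P.coeff 0 = 0}

/-- The polynomial `x ↦ x`. -/
noncomputable def PolyZero.ident : PolyZero := ⟨Polynomial.X, Polynomial.coeff_X_zero⟩

/-- `∑_{i ∈ β} α (G i) + P (∑_{i ∈ β} ∑_{t ∈ H (G i)} f i t)`. -/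
noncomputable def blockValue (α : PosFin (ℕ+ → ℕ+) → ℕ+) (H : PosFin (ℕ+ → ℕ+) → PosFin ℕ+)
    (G : ℕ+ → PosFin (ℕ+ → ℕ+)) (f : ℕ+ → ℕ+ → ℕ+) (P : PolyZero) (β : PosFin ℕ+) : ℤ :=
  (∑ i ∈ β.1, (α (G i) : ℤ)) + P.1.eval (∑ i ∈ β.1, ∑ t ∈ (H (G i)).1, (f i t : ℤ))

/-- The conclusion for `α 0, …, α m` and `H 0, …, H m`: each `H j` is increasing, and along
every strictly increasing sequence `G`, with `f i ∈ G i`, `P j ∈ T` and `β 0 < ⋯ < β m`,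
the linear combination of the block values with coefficients `a j` belongs to `A`. -/
def LinearCombinationProperty (T : PosFin PolyZero) {m : ℕ} (a : Fin (m + 1) → ℕ+) (A : Set ℕ+)
    (α : Fin (m + 1) → PosFin (ℕ+ → ℕ+) → ℕ+)
    (H : Fin (m + 1) → PosFin (ℕ+ → ℕ+) → PosFin ℕ+) : Prop :=
  (∀ F G : PosFin (ℕ+ → ℕ+), F.1 ⊂ G.1 → ∀ j, Before (H j F) (H j G)) ∧
  ∀ G : ℕ+ → PosFin (ℕ+ → ℕ+), (∀ i k, i < k → (G i).1 ⊂ (G k).1) →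
    ∀ P : Fin (m + 1) → PolyZero, (∀ j, P j ∈ T.1) →
    ∀ β : Fin (m + 1) → PosFin ℕ+, (∀ j k, j < k → Before (β j) (β k)) →
    ∀ f : ℕ+ → ℕ+ → ℕ+, (∀ i, f i ∈ (G i).1) →
      IntMem (∑ j, (a j : ℤ) * blockValue (α j) (H j) G f (P j) (β j)) A

/-- The linear-combination conclusion with one pair `α, H` used in all coordinates. -/
def SingleConclusion (T : PosFin PolyZero) {m : ℕ} (a : Fin (m + 1) → ℕ+) (A : Set ℕ+) : Prop :=
  ∃ (α : PosFin (ℕ+ → ℕ+) → ℕ+) (H : PosFin (ℕ+ → ℕ+) → PosFin ℕ+),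
    LinearCombinationProperty T a A (fun _ => α) (fun _ => H)

/-- The linear-combination conclusion with a pair `α j, H j` for each coordinate `j`. -/
def MultipleConclusion (T : PosFin PolyZero) {m : ℕ} (a : Fin (m + 1) → ℕ+) (A : Set ℕ+) : Prop :=
  ∃ (α : Fin (m + 1) → PosFin (ℕ+ → ℕ+) → ℕ+)
    (H : Fin (m + 1) → PosFin (ℕ+ → ℕ+) → PosFin ℕ+),
    LinearCombinationProperty T a A α H

/-! For the passage from `α`, `H` to ultrafilters, consider the sums over chains of finite sets that
lie above a given finite set `F`. They form a `J`-set, and such a sum stays one when a chain sum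
above the end of its chain is added to it. Hence, by compactness and the Ellis–Numakura lemma,
some idempotent all of whose members are `J`-sets contains these sets for all `F` at once.

Conversely, membership of `A` in the linear combination of the `p j` says that the first summand
can be any of `p 0`-many numbers, the second one then any of `p 1`-many, and so on. Idempotence
lets each summand be built up from several terms within these sets. So `α F` and `H F` can be
chosen by recursion on the finite set `F`: the subsets of `F` give rise to only finitely many
partial choices, so that the terms allowed after all of them form a `J`-set. -/

/-! ## `J`-sets -/

/-- The element `b + ∑ t ∈ β, f t` of `ℕ+`, which has no `0` and hence no `Finset.sum`. -/
def shiftedSum (b : ℕ+) (β : PosFin ℕ+) (f : ℕ+ → ℕ+) : ℕ+ :=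
  ⟨b + ∑ t ∈ β.1, (f t : ℕ), Nat.add_pos_left b.pos _⟩

theorem coe_shiftedSum (b : ℕ+) (β : PosFin ℕ+) (f : ℕ+ → ℕ+) :
    (shiftedSum b β f : ℕ) = b + ∑ t ∈ β.1, (f t : ℕ) := rfl

theorem shiftedSum_add_left (x b : ℕ+) (β : PosFin ℕ+) (f : ℕ+ → ℕ+) :
    shiftedSum (x + b) β f = x + shiftedSum b β f :=
  PNat.eq (by simp only [coe_shiftedSum, PNat.add_coe, add_assoc])

theorem intMem_coe {n : ℕ+} {A : Set ℕ+} : IntMem (n : ℤ) A ↔ n ∈ A := by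
  simp [IntMem]

theorem isJSet_iff {A : Set ℕ+} :
    IsJSet A ↔ ∀ F : PosFin (ℕ+ → ℕ+), ∃ b β, ∀ f ∈ F.1, shiftedSum b β f ∈ A := by
  simp only [IsJSet, ← intMem_coe, coe_shiftedSum, Nat.cast_add, Nat.cast_sum]

theorem IsJSet.mono {A B : Set ℕ+} (hA : IsJSet A) (h : A ⊆ B) : IsJSet B := by
  rw [isJSet_iff] at hA ⊢
  intro F
  obtain ⟨b, β, hb⟩ := hA F
  exact ⟨b, β, fun f hf => h (hb f hf)⟩

theorem not_isJSet_empty : ¬ IsJSet ∅ := by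
  intro h
  obtain ⟨b, _, hb⟩ := isJSet_iff.1 h ⟨{1}, Finset.singleton_nonempty _⟩
  exact hb 1 (Finset.mem_singleton_self _)

theorem IsJSet.of_preimage_add_left {A : Set ℕ+} (x : ℕ+) (h : IsJSet ((x + ·) ⁻¹' A)) :
    IsJSet A := by
  rw [isJSet_iff] at h ⊢
  intro F
  obtain ⟨b, β, hb⟩ := h F
  exact ⟨x + b, β, fun f hf => (shiftedSum_add_left x b β f).symm ▸ hb f hf⟩

theorem IsJSet.exists_forall_lt {A : Set ℕ+} (hA : IsJSet A) (F : Finset (ℕ+ → ℕ+)) (N : ℕ+) :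
    ∃ b β, (∀ t ∈ β.1, N < t) ∧ ∀ f ∈ F, shiftedSum b β f ∈ A := by
  classical
  let translate (f : ℕ+ → ℕ+) (t : ℕ+) : ℕ+ := f (N + t)
  obtain ⟨b, β, h⟩ := isJSet_iff.1 hA ⟨insert 1 (F.image translate), Finset.insert_nonempty _ _⟩
  refine ⟨b, ⟨β.1.image (N + ·), β.2.image _⟩, ?_, fun f hf => ?_⟩
  · simp only [Finset.forall_mem_image]
    exact fun t _ => PNat.lt_add_right N t
  · have hsum : shiftedSum b ⟨β.1.image (N + ·), β.2.image _⟩ f = shiftedSum b β (translate f) :=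
      PNat.eq (by simp [coe_shiftedSum, translate])
    exact hsum ▸ h _ (Finset.mem_insert_of_mem (Finset.mem_image_of_mem _ hf))

/-- The function `t ↦ ∑ i, w i (e (t, i))` attached to a word `w` whose letters are functions.
For injective `e`, sums of it over finite sets do not evaluate any two letters at the same place. -/
def wordSum {ι : Type*} [Fintype ι] [Nonempty ι] (e : ℕ+ × ι → ℕ+) (w : ι → ℕ+ → ℕ+)
    (t : ℕ+) : ℕ+ :=
  ⟨∑ i, (w i (e (t, i)) : ℕ), Finset.sum_pos (fun _ _ => PNat.pos _) Finset.univ_nonempty⟩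

theorem exists_shiftedSum_eq_shiftedSum_wordSum {ι L : Type*} [Fintype ι] [Nonempty ι]
    {e : ℕ+ × ι → ℕ+} (he : Function.Injective e) (φ : L → ℕ+ → ℕ+)
    (l : Combinatorics.Line L ι) (b : ℕ+) (β : PosFin ℕ+) :
    ∃ b' β', ∀ x, shiftedSum b' β' (φ x) = shiftedSum b β (wordSum e fun i => φ (l x i)) := by
  classical
  let V : Finset ι := {i | l.idxFun i = none}
  have hV : V.Nonempty := l.proper.imp fun i hi => by simpa [V] using hi
  let fixed (t : ℕ+) (i : ι) : ℕ := (l.idxFun i).elim 0 fun y => (φ y (e (t, i)) : ℕ)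
  -- The constant letters of the line go into the shift, its variable places into the index set.
  obtain ⟨b', hb'⟩ : ∃ b' : ℕ+, (b' : ℕ) = b + ∑ t ∈ β.1, ∑ i, fixed t i :=
    ⟨⟨_, Nat.add_pos_left b.pos _⟩, rfl⟩
  refine ⟨b', ⟨(β.1 ×ˢ V).image e, (β.2.product hV).image e⟩, fun x => PNat.eq ?_⟩
  have hletter (t : ℕ+) (i : ι) : (φ (l x i) (e (t, i)) : ℕ) =
      fixed t i + if l.idxFun i = none then (φ x (e (t, i)) : ℕ) else 0 := by
    cases hi : l.idxFun i <;> simp [fixed, hi]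
  rw [coe_shiftedSum, hb', Finset.sum_image he.injOn, Finset.sum_product]
  simp only [coe_shiftedSum, wordSum, PNat.mk_coe, hletter, Finset.sum_add_distrib,
    ← Finset.sum_filter, add_assoc, V]

/-- By the Hales–Jewett theorem for words with letters in `F`, coloured by membership of the
shifted sum of `wordSum` in `A`. -/
theorem IsJSet.exists_forall_mem_or {A B : Set ℕ+} (h : IsJSet (A ∪ B))
    (F : PosFin (ℕ+ → ℕ+)) :
    (∃ b β, ∀ f ∈ F.1, shiftedSum b β f ∈ A) ∨ ∃ b β, ∀ f ∈ F.1, shiftedSum b β f ∈ B := by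
  classical
  obtain ⟨ι, _, hι⟩ := Combinatorics.Line.exists_mono_in_high_dimension F.1 Prop
  have : Nonempty ι := (hι fun _ => True).elim fun l _ => l.proper.nonempty
  obtain ⟨e, he⟩ := Countable.exists_injective_nat (ℕ+ × ι)
  let sumOf (w : ι → F.1) : ℕ+ → ℕ+ := wordSum (fun y => (e y).succPNat) fun i => (w i).1
  have : Nonempty F.1 := F.2.to_subtype
  obtain ⟨b, β, hb⟩ := isJSet_iff.1 h
    ⟨Finset.univ.image sumOf, Finset.univ_nonempty.image sumOf⟩
  obtain ⟨l, c, hc⟩ := hι fun w => shiftedSum b β (sumOf w) ∈ A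
  obtain ⟨b', β', hline⟩ := exists_shiftedSum_eq_shiftedSum_wordSum
    (Nat.succPNat_injective.comp he) Subtype.val l b β
  have hAB (f : F.1) : shiftedSum b' β' f ∈ A ∪ B :=
    (hline f).symm ▸ hb _ (Finset.mem_image_of_mem sumOf (Finset.mem_univ _))
  have hmono (f : F.1) : shiftedSum b' β' f ∈ A ↔ c := by
    rw [hline f]
    exact iff_of_eq (hc f)
  by_cases hcA : c
  · exact .inl ⟨b', β', fun f hf => (hmono ⟨f, hf⟩).2 hcA⟩
  · exact .inr ⟨b', β', fun f hf =>
      (hAB ⟨f, hf⟩).resolve_left fun hA => hcA ((hmono ⟨f, hf⟩).1 hA)⟩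

theorem IsJSet.of_union {A B : Set ℕ+} (h : IsJSet (A ∪ B)) : IsJSet A ∨ IsJSet B := by
  classical
  by_contra! hAB
  simp only [isJSet_iff, not_forall] at hAB
  obtain ⟨⟨F₁, h₁⟩, F₂, h₂⟩ := hAB
  rcases h.exists_forall_mem_or ⟨F₁.1 ∪ F₂.1, F₁.2.inl⟩ with ⟨b, β, hb⟩ | ⟨b, β, hb⟩
  · exact h₁ ⟨b, β, fun f hf => hb f (Finset.mem_union_left _ hf)⟩
  · exact h₂ ⟨b, β, fun f hf => hb f (Finset.mem_union_right _ hf)⟩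

/-! ## Ultrafilters of `J`-sets -/

/-- The filter of the sets whose complement is not a `J`-set; it encodes the partition regularity
of `J`-sets, and `JUltrafilters` is the set of the ultrafilters finer than it. -/
def coJFilter : Filter ℕ+ :=
  Filter.comk (fun A => ¬ IsJSet A) not_isJSet_empty (fun _ hA _ hBA hB => hA (hB.mono hBA))
    fun _ hA _ hB hAB => hAB.of_union.elim hA hB

theorem mem_coJFilter {A : Set ℕ+} : A ∈ coJFilter ↔ ¬ IsJSet Aᶜ := Iff.rfl

theorem mem_JUltrafilters_iff_le {p : Ultrafilter ℕ+} :
    p ∈ JUltrafilters ↔ (p : Filter ℕ+) ≤ coJFilter := by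
  refine ⟨fun hp A hA => ?_, fun hp A hAp => ?_⟩
  · by_contra hAp
    exact hA (hp _ (Ultrafilter.compl_mem_iff_notMem.2 hAp))
  · by_contra hA
    exact Ultrafilter.compl_mem_iff_notMem.1
      (hp (mem_coJFilter.2 ((compl_compl A).symm ▸ hA))) hAp

theorem isClosed_JUltrafilters : IsClosed JUltrafilters := by
  have : JUltrafilters = ⋂ A ∈ coJFilter, {p : Ultrafilter ℕ+ | A ∈ p} := by
    ext p
    simp only [mem_JUltrafilters_iff_le, Set.mem_iInter]
    rfl
  rw [this]
  exact isClosed_biInter fun A _ => ultrafilter_isClosed_basic A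

theorem IsJSet.exists_mem_JUltrafilters {A : Set ℕ+} (hA : IsJSet A) :
    ∃ p ∈ JUltrafilters, A ∈ p := by
  have : (coJFilter ⊓ Filter.principal A).NeBot := by
    refine Filter.inf_principal_neBot_iff.2 fun U hU => ?_
    by_contra hUA
    exact hU (hA.mono fun x hx hxU => hUA ⟨x, hxU, hx⟩)
  obtain ⟨hJ, hpA⟩ := le_inf_iff.1 (Ultrafilter.of_le (coJFilter ⊓ Filter.principal A))
  exact ⟨_, mem_JUltrafilters_iff_le.2 hJ, Filter.le_principal_iff.1 hpA⟩

theorem add_mem_JUltrafilters (p : Ultrafilter ℕ+) {q : Ultrafilter ℕ+}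
    (hq : q ∈ JUltrafilters) : p + q ∈ JUltrafilters := by
  intro A hA
  obtain ⟨x, hx⟩ := p.nonempty_of_mem hA
  exact (hq _ hx).of_preimage_add_left x

theorem exists_mem_JUltrafilters_of_antitone {ι : Type*} [SemilatticeSup ι] [Nonempty ι]
    {S : ι → Set ℕ+} (hS : Antitone S) (hJ : ∀ i, IsJSet (S i)) :
    ∃ p ∈ JUltrafilters, ∀ i, S i ∈ p := by
  let K (i : ι) : Set (Ultrafilter ℕ+) := JUltrafilters ∩ {p | S i ∈ p}
  have hK_closed (i : ι) : IsClosed (K i) :=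
    isClosed_JUltrafilters.inter (ultrafilter_isClosed_basic _)
  have hK : Antitone K := fun i j hij p hp => ⟨hp.1, Filter.mem_of_superset hp.2 (hS hij)⟩
  obtain ⟨p, hp⟩ := IsCompact.nonempty_iInter_of_directed_nonempty_isCompact_isClosed K
    hK.directed_ge (fun i => (hJ i).exists_mem_JUltrafilters) (fun i => (hK_closed i).isCompact)
    hK_closed
  rw [Set.mem_iInter] at hp
  exact ⟨p, (hp (Classical.arbitrary ι)).1, fun i => (hp i).2⟩

/-- The hypothesis `hadd` makes the ultrafilters containing all `S i` a subsemigroup, and the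
Ellis–Numakura lemma applies to its intersection with `JUltrafilters`. -/
theorem exists_idempotent_mem_JUltrafilters {ι : Type*} [SemilatticeSup ι] [Nonempty ι]
    {S : ι → Set ℕ+} (hS : Antitone S) (hJ : ∀ i, IsJSet (S i))
    (hadd : ∀ i, ∀ x ∈ S i, ∃ j, ∀ y ∈ S j, x + y ∈ S i) :
    ∃ p ∈ JUltrafilters, p + p = p ∧ ∀ i, S i ∈ p := by
  let _ := Ultrafilter.addSemigroup (M := ℕ+)
  let Q : Set (Ultrafilter ℕ+) := JUltrafilters ∩ ⋂ i, {p | S i ∈ p}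
  have hQ_closed : IsClosed Q :=
    isClosed_JUltrafilters.inter (isClosed_iInter fun i => ultrafilter_isClosed_basic (S i))
  have mem_Q {p : Ultrafilter ℕ+} : p ∈ Q ↔ p ∈ JUltrafilters ∧ ∀ i, S i ∈ p :=
    and_congr_right fun _ => Set.mem_iInter
  have hQ_add : ∀ p ∈ Q, ∀ q ∈ Q, p + q ∈ Q := by
    simp only [mem_Q]
    rintro p ⟨-, hpS⟩ q ⟨hq, hqS⟩
    refine ⟨add_mem_JUltrafilters p hq, fun i => ?_⟩
    have : {x | {y | x + y ∈ S i} ∈ q} ∈ p := by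
      filter_upwards [hpS i] with x hx
      obtain ⟨j, hj⟩ := hadd i x hx
      exact Filter.mem_of_superset (hqS j) hj
    exact this
  obtain ⟨p, hp⟩ := exists_mem_JUltrafilters_of_antitone hS hJ
  obtain ⟨p, hpQ, hpp⟩ := exists_idempotent_in_compact_add_subsemigroup
    Ultrafilter.continuous_add_left Q ⟨p, mem_Q.2 hp⟩ hQ_closed.isCompact hQ_add
  exact ⟨p, (mem_Q.1 hpQ).1, hpp, (mem_Q.1 hpQ).2⟩

/-! ## Chain sums -/

/-- A finite set with a chosen element. The sequences `G`, `f` of `LinearCombinationProperty` with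
`f i ∈ G i` are the sequences of pointed finite sets. -/
structure PointedFinset (X : Type*) where
  carrier : Finset X
  point : X
  point_mem : point ∈ carrier

namespace PointedFinset

variable {X : Type*}

instance : Preorder (PointedFinset X) := Preorder.lift carrier

theorem lt_iff {g h : PointedFinset X} : g < h ↔ g.carrier ⊂ h.carrier := Iff.rfl

theorem carrier_nonempty (g : PointedFinset X) : g.carrier.Nonempty := ⟨g.point, g.point_mem⟩

theorem exists_ssubset_carrier [Infinite X] (F : Finset X) :
    ∃ g : PointedFinset X, F ⊂ g.carrier := by
  classical
  obtain ⟨x, hx⟩ := F.exists_notMem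
  exact ⟨⟨insert x F, x, Finset.mem_insert_self x F⟩, Finset.ssubset_insert hx⟩

instance [Infinite X] : Nonempty (PointedFinset X) := (exists_ssubset_carrier ∅).nonempty

instance [Infinite X] : NoMaxOrder (PointedFinset X) :=
  ⟨fun g => exists_ssubset_carrier g.carrier⟩

end PointedFinset

/-- `ChainSum v F E x` says that `x = v g₁ + ⋯ + v gₙ` for some `n ≥ 1` and pointed finite sets
`g₁, …, gₙ` with `F ⊂ g₁ ⊂ ⋯ ⊂ gₙ = E`. -/
inductive ChainSum {X : Type*} (v : PointedFinset X → ℕ+) (F : Finset X) :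
    Finset X → ℕ+ → Prop
  | single {g : PointedFinset X} (hg : F ⊂ g.carrier) : ChainSum v F g.carrier (v g)
  | step {E : Finset X} {x : ℕ+} {g : PointedFinset X} (hx : ChainSum v F E x)
      (hg : E ⊂ g.carrier) : ChainSum v F g.carrier (x + v g)

namespace ChainSum

variable {X : Type*} {v : PointedFinset X → ℕ+} {D E F : Finset X} {x y : ℕ+}

theorem mono_left (hDE : D ⊆ E) (hx : ChainSum v E F x) : ChainSum v D F x := by
  induction hx with
  | single hg => exact .single (hDE.trans_ssubset hg)
  | step _ hg ih => exact ih.step hg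

theorem add (hx : ChainSum v D E x) (hy : ChainSum v E F y) : ChainSum v D F (x + y) := by
  induction hy with
  | single hg => exact hx.step hg
  | step _ hg ih => exact add_assoc x _ _ ▸ ih.step hg

end ChainSum

/-- The element `α G + ∑ t ∈ H G, f t`, for the pointed finite set `(G, f)`. -/
def chainTerm (α : PosFin (ℕ+ → ℕ+) → ℕ+) (H : PosFin (ℕ+ → ℕ+) → PosFin ℕ+)
    (g : PointedFinset (ℕ+ → ℕ+)) : ℕ+ :=
  shiftedSum (α ⟨g.carrier, g.carrier_nonempty⟩) (H ⟨g.carrier, g.carrier_nonempty⟩) g.point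

theorem isJSet_setOf_chainSum_chainTerm (α : PosFin (ℕ+ → ℕ+) → ℕ+)
    (H : PosFin (ℕ+ → ℕ+) → PosFin ℕ+) (F : Finset (ℕ+ → ℕ+)) :
    IsJSet {x | ∃ E, ChainSum (chainTerm α H) F E x} := by
  classical
  refine isJSet_iff.2 fun F' => ?_
  obtain ⟨G, hG⟩ := PointedFinset.exists_ssubset_carrier (F ∪ F'.1)
  have hFG : F ⊂ G.carrier := Finset.subset_union_left.trans_ssubset hG
  have hF'G : F'.1 ⊆ G.carrier := Finset.subset_union_right.trans hG.subset
  let G' : PosFin (ℕ+ → ℕ+) := ⟨G.carrier, G.carrier_nonempty⟩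
  exact ⟨α G', H G', fun f hf => ⟨G.carrier, .single (g := ⟨G.carrier, f, hF'G hf⟩) hFG⟩⟩

theorem exists_idempotent_forall_eventually_chainSum (α : PosFin (ℕ+ → ℕ+) → ℕ+)
    (H : PosFin (ℕ+ → ℕ+) → PosFin ℕ+) :
    ∃ p ∈ JUltrafilters, p + p = p ∧
      ∀ F, ∀ᶠ x in (p : Filter ℕ+), ∃ E, ChainSum (chainTerm α H) F E x := by
  classical
  refine exists_idempotent_mem_JUltrafilters (fun F F' hF x ⟨E, hx⟩ => ⟨E, hx.mono_left hF⟩)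
    (isJSet_setOf_chainSum_chainTerm α H) ?_
  rintro F x ⟨E, hx⟩
  exact ⟨E, fun y ⟨E', hy⟩ => ⟨E', hx.add hy⟩⟩

/-- `BlockSums v F l` says that the list `l`, read from its last entry to its first, consists of
chain sums of `v 0`, `v 1`, … above `∅`, each starting above the set at which the previous one
ends, and that the last one ends at `F`. -/
inductive BlockSums {X : Type*} (v : ℕ → PointedFinset X → ℕ+) : Finset X → List ℕ+ → Prop
  | nil : BlockSums v ∅ []
  | cons {F E : Finset X} {l : List ℕ+} {x : ℕ+} (hl : BlockSums v F l)
      (hx : ChainSum (v l.length) F E x) : BlockSums v E (x :: l)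

/-! ## Chain sums along strictly increasing sequences -/

section Blocks

theorem exists_strictMono_eqOn_Iio {P : Type*} [Preorder P] [NoMaxOrder P] {s : ℕ+ → P}
    (hs : StrictMono s) {N : ℕ+} {x : P} (hx : ∀ i < N, s i < x) :
    ∃ s', StrictMono s' ∧ Set.EqOn s' s (Set.Iio N) ∧ s' N = x := by
  classical
  obtain ⟨u, hu, rfl⟩ := Nat.exists_strictMono' x
  let s' (i : ℕ+) : P := if i < N then s i else u (i - N : ℕ)
  refine ⟨s', fun i j hij => ?_, fun i hi => if_pos hi, by simp [s']⟩
  rcases lt_or_ge j N with hj | hj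
  · simpa only [s', hj, hij.trans hj, if_true] using hs hij
  rcases lt_or_ge i N with hi | hi
  · simpa only [s', hi, hj.not_gt, if_true, if_false] using
      (hx i hi).trans_le (hu.monotone (Nat.zero_le _))
  · simpa only [s', hi.not_gt, hj.not_gt, if_false] using
      hu (Nat.sub_lt_sub_right (PNat.coe_le_coe _ _ |>.2 hi) (PNat.coe_lt_coe _ _ |>.2 hij))

variable {X : Type*} {F E : Finset X}

theorem ChainSum.exists_strictMono [Infinite X] {v : PointedFinset X → ℕ+} {x : ℕ+}
    (hx : ChainSum v F E x) {s : ℕ+ → PointedFinset X} (hs : StrictMono s) {N : ℕ+}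
    (hN : ∀ i < N, (s i).carrier ⊆ F) :
    ∃ (s' : ℕ+ → PointedFinset X) (N' : ℕ+) (β : PosFin ℕ+), StrictMono s' ∧
      Set.EqOn s' s (Set.Iio N) ∧ (∀ i < N', (s' i).carrier ⊆ E) ∧
      (∀ i ∈ β.1, N ≤ i ∧ i < N') ∧ ∑ i ∈ β.1, (v (s' i) : ℤ) = x := by
  classical
  have carrier_subset {s' : ℕ+ → PointedFinset X} (hs' : StrictMono s') (N : ℕ+) :
      ∀ i < N + 1, (s' i).carrier ⊆ (s' N).carrier :=
    fun i hi => hs'.monotone (PNat.lt_add_one_iff.1 hi)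
  induction hx with
  | single hg =>
    obtain ⟨s', hs', heq, rfl⟩ := exists_strictMono_eqOn_Iio hs
      fun i hi => PointedFinset.lt_iff.2 ((hN i hi).trans_ssubset hg)
    exact ⟨s', N + 1, ⟨{N}, Finset.singleton_nonempty N⟩, hs', heq, carrier_subset hs' N,
      by simp, by simp⟩
  | step _ hg ih =>
    obtain ⟨s₁, N₁, β, hs₁, heq₁, hN₁, hβ, hsum⟩ := ih
    obtain ⟨s', hs', heq, rfl⟩ := exists_strictMono_eqOn_Iio hs₁
      fun i hi => PointedFinset.lt_iff.2 ((hN₁ i hi).trans_ssubset hg)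
    have hNN₁ : N < N₁ := β.2.elim fun i hi => (hβ i hi).1.trans_lt (hβ i hi).2
    refine ⟨s', N₁ + 1, ⟨insert N₁ β.1, Finset.insert_nonempty _ _⟩, hs',
      (heq.mono (Set.Iio_subset_Iio hNN₁.le)).trans heq₁, carrier_subset hs' N₁, ?_, ?_⟩
    · simp only [Finset.forall_mem_insert, PNat.lt_add_one_iff]
      exact ⟨⟨hNN₁.le, le_rfl⟩, fun i hi => ⟨(hβ i hi).1, (hβ i hi).2.le⟩⟩
    · rw [Finset.sum_insert fun h => (hβ _ h).2.false, PNat.add_coe, Nat.cast_add, ← hsum,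
        add_comm]
      exact congrArg (· + _) (Finset.sum_congr rfl fun i hi => by rw [heq (hβ i hi).2])

/-- The linear combination of the entries of a list, read from its last entry to its first, with
coefficients `a 0`, `a 1`, …. -/
def weightedSum (a : ℕ → ℕ+) : List ℕ+ → ℤ
  | [] => 0
  | x :: l => weightedSum a l + a l.length * x

variable {v : ℕ → PointedFinset X → ℕ+}

theorem BlockSums.exists_strictMono [Infinite X] {l : List ℕ+} (hl : BlockSums v F l)
    (a : ℕ → ℕ+) :
    ∃ (s : ℕ+ → PointedFinset X) (N : ℕ+) (β : ℕ → PosFin ℕ+), StrictMono s ∧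
      (∀ i < N, (s i).carrier ⊆ F) ∧ (∀ j < l.length, ∀ i ∈ (β j).1, i < N) ∧
      (∀ k < l.length, ∀ j < k, Before (β j) (β k)) ∧
      weightedSum a l = ∑ j ∈ Finset.range l.length, a j * ∑ i ∈ (β j).1, (v j (s i) : ℤ) := by
  induction hl with
  | nil =>
    obtain ⟨s, hs⟩ := Nat.exists_strictMono (PointedFinset X)
    exact ⟨s ∘ PNat.natPred, 1, fun _ => ⟨{1}, Finset.singleton_nonempty 1⟩,
      hs.comp PNat.natPred_strictMono, by simp, by simp, by simp, by simp [weightedSum]⟩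
  | @cons F E l x _ hx ih =>
    obtain ⟨s, N, β, hs, hN, hβN, hβ, hsum⟩ := ih
    obtain ⟨s', N', γ, hs', heq, hN', hγ, hγsum⟩ := hx.exists_strictMono hs hN
    have hNN' : N < N' := γ.2.elim fun i hi => (hγ i hi).1.trans_lt (hγ i hi).2
    have update_of_lt {j : ℕ} (hj : j < l.length) : Function.update β l.length γ j = β j :=
      Function.update_of_ne hj.ne _ _
    refine ⟨s', N', Function.update β l.length γ, hs', hN', ?_, ?_, ?_⟩
    · rw [List.length_cons, Nat.forall_lt_succ_right, Function.update_self]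
      exact ⟨fun j hj i hi => (hβN j hj i (update_of_lt hj ▸ hi)).trans hNN',
        fun i hi => (hγ i hi).2⟩
    · rw [List.length_cons, Nat.forall_lt_succ_right, Function.update_self]
      refine ⟨fun k hk j hj => ?_, fun j hj i hi t ht => ?_⟩
      · rw [update_of_lt hk, update_of_lt (hj.trans hk)]
        exact hβ k hk j hj
      · exact (hβN j hj i (update_of_lt hj ▸ hi)).trans_le (hγ t ht).1
    · rw [weightedSum, hsum, List.length_cons, Finset.sum_range_succ, Function.update_self, hγsum]
      refine congrArg (· + _) (Finset.sum_congr rfl fun j hj => ?_)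
      have hj := Finset.mem_range.1 hj
      rw [update_of_lt hj]
      exact congrArg _ (Finset.sum_congr rfl fun i hi => by rw [heq (hβN j hj i hi)])

theorem ChainSum.of_strictMono {v : PointedFinset X → ℕ+} {s : ℕ+ → PointedFinset X}
    (hs : StrictMono s) (β : PosFin ℕ+) (hF : ∀ i ∈ β.1, F ⊂ (s i).carrier) :
    ∃ x, ∃ i ∈ β.1, ChainSum v F (s i).carrier x ∧ (x : ℤ) = ∑ i ∈ β.1, (v (s i) : ℤ) := by
  classical
  obtain ⟨β, hβ⟩ := β
  induction β using Finset.induction_on_max with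
  | empty => simp at hβ
  | insert n β hn ih =>
    have hnβ : n ∉ β := fun h => (hn n h).false
    rw [Finset.forall_mem_insert] at hF
    rcases β.eq_empty_or_nonempty with rfl | hβ'
    · exact ⟨v (s n), n, by simp, .single hF.1, by simp⟩
    · obtain ⟨x, i, hi, hx, hsum⟩ := ih hβ' hF.2
      refine ⟨x + v (s n), n, by simp, hx.step (hs (hn i hi)), ?_⟩
      rw [Finset.sum_insert hnβ, ← hsum, PNat.add_coe, Nat.cast_add, add_comm]

theorem BlockSums.of_strictMono {s : ℕ+ → PointedFinset X} (hs : StrictMono s) (a : ℕ → ℕ+)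
    (β : ℕ → PosFin ℕ+) (n : ℕ) (hβ : ∀ k < n, ∀ j < k, Before (β j) (β k)) :
    ∃ F l, BlockSums v F l ∧ l.length = n ∧
      (∀ i, (∀ j < n, ∀ t ∈ (β j).1, t < i) → F ⊂ (s i).carrier) ∧
      weightedSum a l = ∑ j ∈ Finset.range n, a j * ∑ i ∈ (β j).1, (v j (s i) : ℤ) := by
  induction n with
  | zero =>
    exact ⟨∅, [], .nil, rfl, fun i _ => Finset.empty_ssubset.2 (s i).carrier_nonempty, rfl⟩
  | succ n ih =>
    obtain ⟨F, l, hl, rfl, hF, hsum⟩ := ih fun k hk => hβ k (hk.trans n.lt_succ_self)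
    obtain ⟨x, i, hi, hx, hxsum⟩ := ChainSum.of_strictMono (v := v l.length) hs (β l.length)
      fun i hi => hF i fun j hj t ht => hβ _ l.length.lt_succ_self j hj t ht i hi
    refine ⟨_, x :: l, hl.cons hx, rfl, fun k hk => hs (hk _ l.length.lt_succ_self i hi), ?_⟩
    rw [weightedSum, hsum, hxsum, Finset.sum_range_succ]

end Blocks

theorem blockValue_ident (α : PosFin (ℕ+ → ℕ+) → ℕ+) (H : PosFin (ℕ+ → ℕ+) → PosFin ℕ+)
    (s : ℕ+ → PointedFinset (ℕ+ → ℕ+)) (β : PosFin ℕ+) :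
    blockValue α H (fun i => ⟨(s i).carrier, (s i).carrier_nonempty⟩) (fun i => (s i).point)
      PolyZero.ident β = ∑ i ∈ β.1, (chainTerm α H (s i) : ℤ) := by
  simp [blockValue, PolyZero.ident, chainTerm, coe_shiftedSum, Finset.sum_add_distrib]

theorem linearCombinationProperty_ident_iff {m : ℕ} {a : Fin (m + 1) → ℕ+} {A : Set ℕ+}
    {α : Fin (m + 1) → PosFin (ℕ+ → ℕ+) → ℕ+} {H : Fin (m + 1) → PosFin (ℕ+ → ℕ+) → PosFin ℕ+} :
    LinearCombinationProperty ⟨{PolyZero.ident}, Finset.singleton_nonempty _⟩ a A α H ↔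
      (∀ F G : PosFin (ℕ+ → ℕ+), F.1 ⊂ G.1 → ∀ j, Before (H j F) (H j G)) ∧
      ∀ s : ℕ+ → PointedFinset (ℕ+ → ℕ+), StrictMono s →
        ∀ β : Fin (m + 1) → PosFin ℕ+, (∀ j k, j < k → Before (β j) (β k)) →
          IntMem (∑ j, (a j : ℤ) * ∑ i ∈ (β j).1, (chainTerm (α j) (H j) (s i) : ℤ)) A := by
  refine and_congr_right fun _ => ⟨fun h s hs β hβ => ?_, fun h G hG P hP β hβ f hf => ?_⟩
  · simp only [← blockValue_ident]
    exact h _ (fun i k hik => hs hik) _ (fun _ => Finset.mem_singleton_self _) β hβ _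
      fun i => (s i).point_mem
  · obtain rfl : P = fun _ => PolyZero.ident := funext fun j => Finset.mem_singleton.1 (hP j)
    have := h (fun i => ⟨(G i).1, f i, hf i⟩) (fun i k hik => hG i k hik) β hβ
    simpa only [← blockValue_ident] using this

theorem linearCombinationProperty_ident_iff_blockSums {m : ℕ} {a : Fin (m + 1) → ℕ+} {A : Set ℕ+}
    {α : Fin (m + 1) → PosFin (ℕ+ → ℕ+) → ℕ+} {H : Fin (m + 1) → PosFin (ℕ+ → ℕ+) → PosFin ℕ+} :
    LinearCombinationProperty ⟨{PolyZero.ident}, Finset.singleton_nonempty _⟩ a A α H ↔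
      (∀ F G : PosFin (ℕ+ → ℕ+), F.1 ⊂ G.1 → ∀ j, Before (H j F) (H j G)) ∧
      ∀ F l,
        BlockSums (fun j => chainTerm (α (Fin.ofNat (m + 1) j)) (H (Fin.ofNat (m + 1) j))) F l →
        l.length = m + 1 → IntMem (weightedSum (fun j => a (Fin.ofNat (m + 1) j)) l) A := by
  rw [linearCombinationProperty_ident_iff]
  refine and_congr_right fun _ => ⟨fun h F l hl hm => ?_, fun h s hs β hβ => ?_⟩
  · obtain ⟨s, -, β, hs, -, -, hβ, hsum⟩ := hl.exists_strictMono fun j => a (Fin.ofNat (m + 1) j)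
    rw [hm] at hβ hsum
    rw [hsum, Finset.sum_range]
    simpa using h s hs (fun j => β j) fun j k hjk => hβ k k.2 j hjk
  · obtain ⟨F, l, hl, hm, -, hsum⟩ := BlockSums.of_strictMono
      (v := fun j => chainTerm (α (Fin.ofNat (m + 1) j)) (H (Fin.ofNat (m + 1) j))) hs
      (fun j => a (Fin.ofNat (m + 1) j)) (fun j => β (Fin.ofNat (m + 1) j)) (m + 1)
      fun k hk j hj => hβ _ _ (by simpa [Fin.lt_def, Nat.mod_eq_of_lt, hk, hj.trans hk] using hj)
    have := h F l hl hm
    rw [hsum, Finset.sum_range] at this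
    simpa using this

/-! ## Iterated quantification over ultrafilters -/

/-- `EventuallyExtends p R r l` says that, for `p`-most `r`-tuples `(x₁, …, xᵣ)` in the sense of
iterated quantification, the list `xᵣ :: ⋯ :: x₁ :: l` satisfies `R`; the ultrafilter `p j` is the
one for the entry that follows `j` others. -/
def EventuallyExtends (p : ℕ → Ultrafilter ℕ+) (R : List ℕ+ → Prop) : ℕ → List ℕ+ → Prop
  | 0, l => R l
  | r + 1, l => ∀ᶠ x in (p l.length : Filter ℕ+), EventuallyExtends p R r (x :: l)

theorem preimage_add_mem_linCombUltrafilter_iff {p : ℕ → Ultrafilter ℕ+} {a : ℕ → ℕ+} {B : Set ℤ}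
    (m : ℕ) (l : List ℕ+) :
    {z : ℕ+ | weightedSum a l + z ∈ B} ∈
      linCombUltrafilter m (fun i => a (l.length + i)) (fun i => p (l.length + i)) ↔
      EventuallyExtends p (fun l => weightedSum a l ∈ B) (m + 1) l := by
  induction m generalizing l with
  | zero => exact Iff.rfl
  | succ m ih =>
    have hlen (i : Fin (m + 1)) : l.length + (i.succ : ℕ) = l.length + 1 + i := by
      simp [add_comm, add_left_comm]
    change (∀ᶠ x in (p l.length : Filter ℕ+),
      {z : ℕ+ | weightedSum a l + ((a l.length * x + z : ℕ+) : ℤ) ∈ B} ∈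
        linCombUltrafilter m (fun i => a (l.length + i.succ)) fun i => p (l.length + i.succ)) ↔
      ∀ᶠ x in (p l.length : Filter ℕ+),
        EventuallyExtends p (fun l => weightedSum a l ∈ B) (m + 1) (x :: l)
    simp only [← ih, weightedSum, List.length_cons, hlen, PNat.add_coe, PNat.mul_coe,
      Nat.cast_add, Nat.cast_mul, ← add_assoc]

theorem mem_linCombUltrafilter_iff_eventuallyExtends {m : ℕ} {a : Fin (m + 1) → ℕ+}
    {p : Fin (m + 1) → Ultrafilter ℕ+} {A : Set ℕ+} :
    A ∈ linCombUltrafilter m a p ↔ EventuallyExtends (fun j => p (Fin.ofNat (m + 1) j))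
      (fun l => IntMem (weightedSum (fun j => a (Fin.ofNat (m + 1) j)) l) A) (m + 1) [] := by
  have := preimage_add_mem_linCombUltrafilter_iff (p := fun j => p (Fin.ofNat (m + 1) j))
    (a := fun j => a (Fin.ofNat (m + 1) j)) (B := {z | IntMem z A}) m []
  simpa [weightedSum, intMem_coe] using this

theorem BlockSums.eventuallyExtends {X : Type*} {v : ℕ → PointedFinset X → ℕ+}
    {p : ℕ → Ultrafilter ℕ+}
    (hp : ∀ j F, ∀ᶠ x in (p j : Filter ℕ+), ∃ E, ChainSum (v j) F E x) {n : ℕ}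
    {R : List ℕ+ → Prop} (hR : ∀ F l, BlockSums v F l → l.length = n → R l) {r : ℕ}
    {F : Finset X} {l : List ℕ+} (hl : BlockSums v F l) (hn : l.length + r = n) :
    EventuallyExtends p R r l := by
  induction r generalizing F l with
  | zero => exact hR F l hl hn
  | succ r ih =>
    filter_upwards [hp l.length F] with x ⟨E, hx⟩
    exact ih (hl.cons hx) (by rw [List.length_cons]; omega)

/-! ## Choosing `α` and `H` by recursion on finite sets -/

theorem eventually_and_eventually_add_of_idempotent {M : Type*} [Add M] {p : Ultrafilter M}
    (hp : p + p = p) {Q : M → Prop} (hQ : ∀ᶠ z in (p : Filter M), Q z) :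
    ∀ᶠ z in (p : Filter M), Q z ∧ ∀ᶠ w in (p : Filter M), Q (z + w) :=
  hQ.and (by rwa [← hp, Ultrafilter.eventually_add] at hQ)

theorem exists_forall_lt_of_forall_finset {X D : Type*} [Preorder X] [WellFoundedLT X]
    [LocallyFiniteOrderBot X] (P : D → Prop) (r : D → X → D → Prop)
    (h : ∀ x (s : Finset D), (∀ d ∈ s, P d) → ∃ d, P d ∧ ∀ c ∈ s, r c x d) :
    ∃ W : X → D, (∀ x, P (W x)) ∧ ∀ x, ∀ y < x, r (W y) x (W x) := by
  classical
  rcases isEmpty_or_nonempty X with _ | ⟨⟨x₀⟩⟩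
  · exact ⟨isEmptyElim, isEmptyElim, isEmptyElim⟩
  have : Nonempty D := (h x₀ ∅ (by simp)).nonempty
  choose! next hnext using h
  let W : X → D := wellFounded_lt.fix fun x W =>
    next x ((Finset.Iio x).attach.image fun y : Finset.Iio x => W y.1 (Finset.mem_Iio.1 y.2))
  have hW (x : X) : W x = next x ((Finset.Iio x).image W) := by
    have himage : (Finset.Iio x).attach.image (fun y : Finset.Iio x => W y.1) =
        (Finset.Iio x).image W := by
      ext; simp
    rw [← himage]
    exact wellFounded_lt.fix_eq _ x
  have hP (x : X) : P (W x) := by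
    induction x using WellFoundedLT.induction with
    | _ x ih =>
      rw [hW]
      exact (hnext x _ (by simpa using ih)).1
  refine ⟨W, hP, fun x y hyx => ?_⟩
  rw [hW x]
  exact (hnext x _ (by simp [hP])).2 _ (Finset.mem_image_of_mem W (Finset.mem_Iio.2 hyx))

/-- The lists obtained from a list by putting one more entry in front of it, or by adding to its
first entry; what is put or added is `ζ k`, for the index `k` that `c` gives to that entry. -/
def extensions {ι : Type*} (c : ℕ → ι) (ζ : ι → ℕ+) : List ℕ+ → Finset (List ℕ+)
  | [] => {[ζ (c 0)]}
  | y :: l => {ζ (c (l.length + 1)) :: y :: l, (y + ζ (c l.length)) :: l}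

theorem cons_mem_extensions {ι : Type*} (c : ℕ → ι) (ζ : ι → ℕ+) (l : List ℕ+) :
    ζ (c l.length) :: l ∈ extensions c ζ l := by
  cases l <;> simp [extensions]

/-- A list in `T` such that adding `p`-most numbers to its first entry does not leave `T`, where
`p j` is the ultrafilter for the entry that follows `j` others. -/
def Extensible (p : ℕ → Ultrafilter ℕ+) (T : List ℕ+ → Prop) : List ℕ+ → Prop
  | [] => T []
  | y :: l => T (y :: l) ∧ ∀ᶠ z in (p l.length : Filter ℕ+), T ((y + z) :: l)

namespace Extensible

variable {p : ℕ → Ultrafilter ℕ+} {T : List ℕ+ → Prop} {l : List ℕ+} {y : ℕ+}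

theorem prop (hl : Extensible p T l) : T l := by
  cases l with
  | nil => exact hl
  | cons => exact hl.1

theorem eventually_cons (hp : p l.length + p l.length = p l.length)
    (hl : ∀ᶠ z in (p l.length : Filter ℕ+), T (z :: l)) :
    ∀ᶠ z in (p l.length : Filter ℕ+), Extensible p T (z :: l) :=
  eventually_and_eventually_add_of_idempotent hp hl

theorem eventually_add_cons (hp : p l.length + p l.length = p l.length)
    (hl : Extensible p T (y :: l)) :
    ∀ᶠ z in (p l.length : Filter ℕ+), Extensible p T ((y + z) :: l) := by
  simpa only [Extensible, add_assoc] using eventually_and_eventually_add_of_idempotent hp hl.2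

theorem exists_forall_mem_extensions {ι : Type*} {p : ι → Ultrafilter ℕ+}
    (hp : ∀ k, p k + p k = p k) {c : ℕ → ι}
    (hT : ∀ l, T l → ∀ᶠ z in (p (c l.length) : Filter ℕ+), T (z :: l))
    (hl : Extensible (fun j => p (c j)) T l) :
    ∃ Y : ι → Set ℕ+, (∀ k, Y k ∈ p k) ∧
      ∀ ζ, (∀ k, ζ k ∈ Y k) → ∀ l' ∈ extensions c ζ l, Extensible (fun j => p (c j)) T l' := by
  let Good := Extensible (fun j => p (c j)) T
  have eventually_of_eq {j : ℕ} {Q : ℕ+ → Prop} (hQ : ∀ᶠ z in (p (c j) : Filter ℕ+), Q z)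
      (k : ι) : ∀ᶠ z in (p k : Filter ℕ+), c j = k → Q z :=
    Filter.eventually_imp_distrib_left.2 fun hk => hk ▸ hQ
  have hcons (k : ι) : ∀ᶠ z in (p k : Filter ℕ+), c l.length = k → Good (z :: l) :=
    eventually_of_eq (eventually_cons (p := fun j => p (c j)) (hp _) (hT l hl.prop)) k
  cases l with
  | nil =>
    refine ⟨_, hcons, fun ζ hζ => ?_⟩
    simpa [extensions] using hζ (c 0) rfl
  | cons y l =>
    have hadd (k : ι) : ∀ᶠ z in (p k : Filter ℕ+), c l.length = k → Good ((y + z) :: l) :=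
      eventually_of_eq (hl.eventually_add_cons (hp _)) k
    refine ⟨_, fun k => (hcons k).and (hadd k), fun ζ hζ => ?_⟩
    simpa [extensions] using ⟨(hζ _).1 rfl, (hζ _).2 rfl⟩

end Extensible

/-- What is chosen for one finite set `F` of functions: the values `α k F` and `H k F`, and a
finite set of lists containing those that arise from chains of finite sets ending at `F`. -/
structure Stage (ι : Type*) where
  shift : ι → ℕ+
  indices : ι → PosFin ℕ+
  lists : Finset (List ℕ+)

namespace Stage

variable {ι : Type*}

/-- The value that a function contributes at a stage. -/
def term (d : Stage ι) (f : ℕ+ → ℕ+) (k : ι) : ℕ+ := shiftedSum (d.shift k) (d.indices k) f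

/-- The index sets of `d'` lie beyond those of `d`, and `d'` keeps the extensions of the lists
of `d`. -/
def Compatible (c : ℕ → ι) (d : Stage ι) (F : Finset (ℕ+ → ℕ+)) (d' : Stage ι) : Prop :=
  (∀ k, Before (d.indices k) (d'.indices k)) ∧
    ∀ l ∈ d.lists, ∀ f ∈ F, extensions c (d'.term f) l ⊆ d'.lists

variable {p : ι → Ultrafilter ℕ+} {c : ℕ → ι} {T : List ℕ+ → Prop}

theorem exists_compatible (hpJ : ∀ k, p k ∈ JUltrafilters) (hp : ∀ k, p k + p k = p k)
    (hT_nil : T []) (hT : ∀ l, T l → ∀ᶠ z in (p (c l.length) : Filter ℕ+), T (z :: l))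
    (F : Finset (ℕ+ → ℕ+)) (s : Finset (Stage ι))
    (hs : ∀ d ∈ s, ∀ l ∈ d.lists, Extensible (fun j => p (c j)) T l) :
    ∃ d' : Stage ι, ([] ∈ d'.lists ∧ ∀ l ∈ d'.lists, Extensible (fun j => p (c j)) T l) ∧
      ∀ d ∈ s, d.Compatible c F d' := by
  classical
  let L : Finset (List ℕ+) := s.biUnion lists
  have hL : ∀ l ∈ L, Extensible (fun j => p (c j)) T l := by
    simp only [L, Finset.mem_biUnion]
    rintro l ⟨d, hd, hl⟩
    exact hs d hd l hl
  choose! Y hYp hY using fun l hl => (hL l hl).exists_forall_mem_extensions hp hT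
  have hY_mem (k : ι) : (⋂ l ∈ L, Y l k) ∈ p k :=
    (Filter.biInter_finset_mem L).2 fun l hl => hYp l hl k
  choose N hN using fun k => (s.biUnion fun d => (d.indices k).1).exists_le
  choose b β hβ hb using fun k => (hpJ k _ (hY_mem k)).exists_forall_lt F (N k)
  let ζ (f : ℕ+ → ℕ+) (k : ι) : ℕ+ := shiftedSum (b k) (β k) f
  let d' : Stage ι := ⟨b, β, insert [] (L.biUnion fun l => F.biUnion fun f => extensions c (ζ f) l)⟩
  refine ⟨d', ⟨Finset.mem_insert_self _ _, ?_⟩, fun d hd => ⟨fun k t ht u hu => ?_, ?_⟩⟩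
  · simp only [d', Finset.forall_mem_insert, Finset.mem_biUnion]
    refine ⟨hT_nil, ?_⟩
    rintro l' ⟨l, hl, f, hf, hl'⟩
    exact hY l hl (ζ f) (fun k => Set.mem_iInter₂.1 (hb k f hf) l hl) l' hl'
  · exact (hN k t (Finset.mem_biUnion.2 ⟨d, hd, ht⟩)).trans_lt (hβ k u hu)
  · intro l hl f hf l' hl'
    exact Finset.mem_insert_of_mem (Finset.mem_biUnion.2
      ⟨l, Finset.mem_biUnion.2 ⟨d, hd, hl⟩, Finset.mem_biUnion.2 ⟨f, hf, hl'⟩⟩)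

end Stage

theorem exists_forall_blockSums {ι : Type*} {p : ι → Ultrafilter ℕ+} {c : ℕ → ι}
    {T : List ℕ+ → Prop} (hpJ : ∀ k, p k ∈ JUltrafilters) (hp : ∀ k, p k + p k = p k)
    (hT_nil : T []) (hT : ∀ l, T l → ∀ᶠ z in (p (c l.length) : Filter ℕ+), T (z :: l)) :
    ∃ (α : ι → PosFin (ℕ+ → ℕ+) → ℕ+) (H : ι → PosFin (ℕ+ → ℕ+) → PosFin ℕ+),
      (∀ F G : PosFin (ℕ+ → ℕ+), F.1 ⊂ G.1 → ∀ k, Before (H k F) (H k G)) ∧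
      ∀ F l, BlockSums (fun j => chainTerm (α (c j)) (H (c j))) F l → T l := by
  classical
  obtain ⟨W, hW, hWr⟩ := exists_forall_lt_of_forall_finset
    (fun d : Stage ι => [] ∈ d.lists ∧ ∀ l ∈ d.lists, Extensible (fun j => p (c j)) T l)
    (Stage.Compatible c) fun F s hs =>
      Stage.exists_compatible hpJ hp hT_nil hT F s fun d hd => (hs d hd).2
  let α (k : ι) (G : PosFin (ℕ+ → ℕ+)) : ℕ+ := (W G.1).shift k
  let H (k : ι) (G : PosFin (ℕ+ → ℕ+)) : PosFin ℕ+ := (W G.1).indices k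
  have hchain {F E l x} (hl : l ∈ (W F).lists)
      (hx : ChainSum (chainTerm (α (c l.length)) (H (c l.length))) F E x) :
      x :: l ∈ (W E).lists := by
    induction hx with
    | @single g hg =>
      exact (hWr _ _ hg).2 l hl _ g.point_mem (cons_mem_extensions c ((W g.carrier).term g.point) l)
    | @step E x g _ hg ih =>
      exact (hWr _ _ hg).2 _ ih _ g.point_mem
        (Finset.mem_insert_of_mem (Finset.mem_singleton_self _))
  have hblocks {F l} (hl : BlockSums (fun j => chainTerm (α (c j)) (H (c j))) F l) :
      l ∈ (W F).lists := by
    induction hl with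
    | nil => exact (hW ∅).1
    | cons _ hx ih => exact hchain ih hx
  exact ⟨α, H, fun F G hFG k => (hWr _ _ hFG).1 k, fun F l hl => ((hW F).2 l (hblocks hl)).prop⟩

theorem exists_forall_blockSums_of_eventuallyExtends {ι : Type*} {p : ι → Ultrafilter ℕ+}
    (hpJ : ∀ k, p k ∈ JUltrafilters) (hp : ∀ k, p k + p k = p k) {c : ℕ → ι} {n : ℕ}
    {R : List ℕ+ → Prop} (hR : EventuallyExtends (fun j => p (c j)) R n []) :
    ∃ (α : ι → PosFin (ℕ+ → ℕ+) → ℕ+) (H : ι → PosFin (ℕ+ → ℕ+) → PosFin ℕ+),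
      (∀ F G : PosFin (ℕ+ → ℕ+), F.1 ⊂ G.1 → ∀ k, Before (H k F) (H k G)) ∧
      ∀ F l, BlockSums (fun j => chainTerm (α (c j)) (H (c j))) F l → l.length = n → R l := by
  let T (l : List ℕ+) : Prop := ∀ r, l.length + r = n → EventuallyExtends (fun j => p (c j)) R r l
  have hT_nil : T [] := by
    rintro r hr
    obtain rfl : r = n := by simpa using hr
    exact hR
  have hT : ∀ l, T l → ∀ᶠ z in (p (c l.length) : Filter ℕ+), T (z :: l) := by
    intro l hl
    rcases lt_or_ge l.length n with hn | hn
    · obtain ⟨r, rfl⟩ := Nat.exists_eq_add_of_lt hn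
      filter_upwards [hl (r + 1) (by omega)] with z hz r' hr'
      obtain rfl : r' = r := by rw [List.length_cons] at hr'; omega
      exact hz
    · refine .of_forall fun z r hr => ?_
      rw [List.length_cons] at hr
      omega
  obtain ⟨α, H, hH, hαH⟩ := exists_forall_blockSums hpJ hp hT_nil hT
  exact ⟨α, H, hH, fun F l hl hn => hαH F l hl 0 hn⟩

theorem exists_linearCombinationProperty_iff {ι : Type*} {m : ℕ} (c : Fin (m + 1) → ι)
    (a : Fin (m + 1) → ℕ+) (A : Set ℕ+) :
    (∃ (α : ι → PosFin (ℕ+ → ℕ+) → ℕ+) (H : ι → PosFin (ℕ+ → ℕ+) → PosFin ℕ+),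
      LinearCombinationProperty ⟨{PolyZero.ident}, Finset.singleton_nonempty _⟩ a A
        (fun j => α (c j)) (fun j => H (c j))) ↔
    ∃ p : ι → Ultrafilter ℕ+, (∀ k, p k ∈ JUltrafilters ∧ p k + p k = p k) ∧
      A ∈ linCombUltrafilter m a (fun j => p (c j)) := by
  simp only [linearCombinationProperty_ident_iff_blockSums,
    mem_linCombUltrafilter_iff_eventuallyExtends]
  constructor
  · rintro ⟨α, H, -, hA⟩
    choose p hpJ hpp hp using fun k => exists_idempotent_forall_eventually_chainSum (α k) (H k)
    exact ⟨p, fun k => ⟨hpJ k, hpp k⟩,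
      BlockSums.eventuallyExtends (fun j => hp _) hA .nil (Nat.zero_add _)⟩
  · rintro ⟨p, hp, hA⟩
    obtain ⟨α, H, hH, hαH⟩ := exists_forall_blockSums_of_eventuallyExtends
      (fun k => (hp k).1) (fun k => (hp k).2) hA
    exact ⟨α, H, fun F G hFG j => hH F G hFG (c j), hαH⟩

/-- There are `m + 1` coefficients `a 0, …, a m`, so that their number is an arbitrary positive
integer. -/
theorem mainTheorem10 (m : ℕ) (a : Fin (m + 1) → ℕ+) (A : Set ℕ+) (T : PosFin PolyZero)
    (hT : T = ⟨{PolyZero.ident}, Finset.singleton_nonempty _⟩) :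
    (SingleConclusion T a A ↔
      ∃ p ∈ JUltrafilters, p + p = p ∧ A ∈ linCombUltrafilter m a (fun _ => p)) ∧
    (MultipleConclusion T a A ↔
      ∃ p : Fin (m + 1) → Ultrafilter ℕ+, (∀ j, p j ∈ JUltrafilters ∧ p j + p j = p j) ∧
        A ∈ linCombUltrafilter m a p) := by
  subst hT
  refine ⟨?_, exists_linearCombinationProperty_iff id a A⟩
  have h := exists_linearCombinationProperty_iff (fun _ : Fin (m + 1) => ()) a A
  constructor
  · rintro ⟨α, H, hαH⟩
    obtain ⟨p, hp, hA⟩ := h.1 ⟨fun _ => α, fun _ => H, hαH⟩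
    exact ⟨p (), (hp ()).1, (hp ()).2, hA⟩
  · rintro ⟨p, hpJ, hpp, hA⟩
    obtain ⟨α, H, hαH⟩ := h.2 ⟨fun _ => p, fun _ => ⟨hpJ, hpp⟩, hA⟩
    exact ⟨α (), H (), hαH⟩
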